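/- Let $\mathbb D$ be the open unit disc and let $H^2$ be the Hardy space of holomorphic functions $f(z)=\sum_{k\ge 0} f_k z^k$ on $\mathbb D$ with $\|f\|^2=\sum_k |f_k|^2<\infty$. Let $S$ be the shift operator on $H^2$, $(Sf)(z)=zf(z)$. Let $0\le J<n$ be integers, let $z_1,\dots,z_n\in\mathbb D$ and $a_1,\dots,a_J\in\mathbb D$ (repetitions allowed), let $\gamma,c\in\mathbb C$ with $|\gamma|=|c|=1$, and let $$\Theta(z)=\gamma\prod_{i=1}^n\frac{z-z_i}{1-\overline{z_i}z},\qquad B(z)=c\prod_{j=1}^J\frac{z-a_j}{1-\overline{a_j}z}$$ be the corresponding finite Blaschke products. Let $K_\Theta=H^2\ominus\Theta H^2$ be the orthogonal complement of $\Theta H^2=\{\Theta h: h\in H^2\}$ in $H^2$, let $P_\Theta$ be the orthogonal projection of $H^2$ onto $K_\Theta$, and let $S_\Theta=P_\Theta S|_{K_\Theta}:K_\Theta\to K_\Theta$ be the compression of the shift. Let $B(S_\Theta)=c\prod_{j=1}^J (S_\Theta-a_j I)(I-\overline{a_j}S_\Theta)^{-1}$. Then for each $x\in K_\Theta$ the following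 are equivalent: 1. $\|B(S_\Theta)x\|=\|x\|$; 2. $Bx\in K_\Theta$, where $(Bx)(z)=B(z)x(z)$; 3. there is a polynomial $p\in\mathbb C[z]$ with $\deg p<n-J$ (the zero polynomial being allowed) such that for all $z\in\mathbb D$ $$x(z)=\frac{p(z)\prod_{j=1}^J(1-\overline{a_j}z)}{\prod_{i=1}^n(1-\overline{z_i}z)}.$$ -/

import Mathlib

open scoped Complex.UnitDisc ComplexConjugate Polynomial

noncomputable section

namespace ModelSpace

/-- The square-summable sequences of complex numbers, indexed by `ℕ`. -/
abbrev EllTwo : Type := lp (fun _ : ℕ => ℂ) 2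

/-- Square-summable coefficients give a power series that converges on the open unit disc. -/
theorem summable_coeff_mul_pow (a : EllTwo) (z : 𝔻) :
    Summable fun n => a n * (z : ℂ) ^ n := by
  refine Summable.of_norm_bounded (g := fun n => ‖a‖ * ‖(z : ℂ)‖ ^ n)
    ((summable_geometric_of_lt_one (norm_nonneg _) z.norm_lt_one).mul_left _) fun n => ?_
  rw [norm_mul, norm_pow]
  exact mul_le_mul_of_nonneg_right (lp.norm_apply_le_norm two_ne_zero a n) (by positivity)

/-- The coefficients of such a power series are determined by its values on the disc. -/
theorem coeff_unique {f : 𝔻 → ℂ} {a b : EllTwo}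
    (ha : ∀ z : 𝔻, HasSum (fun n => a n * (z : ℂ) ^ n) (f z))
    (hb : ∀ z : 𝔻, HasSum (fun n => b n * (z : ℂ) ^ n) (f z)) : a = b := by
  have key : ∀ a : EllTwo, (∀ z : 𝔻, HasSum (fun n => a n * (z : ℂ) ^ n) (f z)) →
      HasFPowerSeriesAt (fun z : ℂ => if h : ‖z‖ < 1 then f (Complex.UnitDisc.mk z h) else 0)
        (FormalMultilinearSeries.ofScalars ℂ (fun n => a n)) 0 := by
    intro a ha
    rw [hasFPowerSeriesAt_iff]
    filter_upwards [Metric.ball_mem_nhds (0 : ℂ) one_pos] with z hz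
    have hz' : ‖z‖ < 1 := by simpa using hz
    have h := ha (Complex.UnitDisc.mk z hz')
    simpa [hz', mul_comm] using h
  have h := (key a ha).eq_formalMultilinearSeries (key b hb)
  ext n
  have := congrArg (fun p => p.coeff n) h
  simpa using this

/-- The functions on the open unit disc that are sums of power series with square-summable
coefficients. -/
def hardySubmodule : Submodule ℂ (𝔻 → ℂ) where
  carrier := {f | ∃ a : EllTwo, ∀ z : 𝔻, HasSum (fun n => a n * (z : ℂ) ^ n) (f z)}
  zero_mem' := ⟨0, fun z => by simp⟩
  add_mem' := by
    rintro f g ⟨a, ha⟩ ⟨b, hb⟩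
    exact ⟨a + b, fun z => by simpa [add_mul] using (ha z).add (hb z)⟩
  smul_mem' := by
    rintro c f ⟨a, ha⟩
    exact ⟨c • a, fun z => by simpa [mul_assoc] using (ha z).mul_left c⟩

/-- The Hardy space `H²` of the open unit disc: the holomorphic functions on the disc whose Taylor
coefficients at `0` are square-summable, with pointwise addition and scalar multiplication. -/
def Hardy : Type := hardySubmodule

namespace Hardy

instance : AddCommGroup Hardy := inferInstanceAs (AddCommGroup hardySubmodule)

instance : Module ℂ Hardy := inferInstanceAs (Module ℂ hardySubmodule)

instance : CoeFun Hardy fun _ => 𝔻 → ℂ := ⟨fun f => f.1⟩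

/-- The function on the disc with a given square-summable sequence of Taylor coefficients. -/
def ofCoeff (a : EllTwo) : Hardy :=
  ⟨fun z => ∑' n, a n * (z : ℂ) ^ n, a, fun z => (summable_coeff_mul_pow a z).hasSum⟩

/-- The sequence of Taylor coefficients at `0` of a function in the Hardy space. -/
def coeffFun (f : Hardy) : EllTwo := f.2.choose

theorem hasSum_coeffFun (f : Hardy) (z : 𝔻) :
    HasSum (fun n => coeffFun f n * (z : ℂ) ^ n) (f z) := f.2.choose_spec z

/-- Taylor coefficients, as a linear bijection from the Hardy space onto `ℓ²`. -/
def coeff : Hardy ≃ₗ[ℂ] EllTwo where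
  toFun := coeffFun
  invFun := ofCoeff
  map_add' f g := coeff_unique (f := fun z => f z + g z) (hasSum_coeffFun (f + g)) fun z => by
    simpa [add_mul] using (hasSum_coeffFun f z).add (hasSum_coeffFun g z)
  map_smul' c f := coeff_unique (f := fun z => c * f z) (hasSum_coeffFun (c • f)) fun z => by
    simpa [mul_assoc] using (hasSum_coeffFun f z).mul_left c
  left_inv f := Subtype.ext (funext fun z => (hasSum_coeffFun f z).tsum_eq)
  right_inv a := coeff_unique (hasSum_coeffFun (ofCoeff a)) fun z =>
    (summable_coeff_mul_pow a z).hasSum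

/-- The norm of `f` in `H²` is the `ℓ²` norm of its Taylor coefficients. -/
instance : NormedAddCommGroup Hardy :=
  NormedAddCommGroup.induced Hardy EllTwo coeff coeff.injective

/-- The inner product of `f` and `g` in `H²` is that of their Taylor coefficients in `ℓ²`. -/
instance : InnerProductSpace ℂ Hardy where
  norm_smul_le c f := by
    change ‖coeff (c • f)‖ ≤ ‖c‖ * ‖coeff f‖
    rw [map_smul, norm_smul]
  inner f g := inner ℂ (coeff f) (coeff g)
  norm_sq_eq_re_inner f := InnerProductSpace.norm_sq_eq_re_inner (coeff f)
  conj_inner_symm f g := InnerProductSpace.conj_inner_symm (coeff f) (coeff g)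
  add_left f g h := by
    change inner ℂ (coeff (f + g)) (coeff h) = _
    rw [map_add, inner_add_left]
  smul_left f g c := by
    change inner ℂ (coeff (c • f)) (coeff g) = _
    rw [map_smul, inner_smul_left]

/-- Taylor coefficients, as a linear isometry from the Hardy space onto `ℓ²`. -/
def coeffₗᵢ : Hardy ≃ₗᵢ[ℂ] EllTwo where
  toLinearEquiv := coeff
  norm_map' _ := rfl

instance : CompleteSpace Hardy :=
  (coeffₗᵢ.toIsometryEquiv.completeSpace_iff).2 inferInstance

/-- The coefficient sequence `(0, a₀, a₁, …)`. -/
def shiftSeq (a : EllTwo) : ℕ → ℂ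
  | 0 => 0
  | n + 1 => a n

theorem hasSum_shiftSeq (a : EllTwo) :
    HasSum (fun n => ‖shiftSeq a n‖ ^ (2 : ENNReal).toReal) (‖a‖ ^ (2 : ENNReal).toReal) := by
  rw [← hasSum_nat_add_iff' 1]
  simpa [shiftSeq] using lp.hasSum_norm (p := 2) (by simp) a

theorem memℓp_shiftSeq (a : EllTwo) : Memℓp (shiftSeq a) 2 :=
  memℓp_gen (hasSum_shiftSeq a).summable

theorem hasSum_shiftSeq_mul_pow (f : Hardy) (z : 𝔻) :
    HasSum (fun n => shiftSeq (coeff f) n * (z : ℂ) ^ n) ((z : ℂ) * f z) := by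
  rw [← hasSum_nat_add_iff' 1]
  have h := (hasSum_coeffFun f z).mul_left (z : ℂ)
  simp only [shiftSeq, Finset.range_one, Finset.sum_singleton, zero_mul, sub_zero, pow_succ]
  convert! h using 2 with n
  change coeffFun f n * _ = _
  ring

/-- The shift operator `(S f)(z) = z f(z)` on the Hardy space. -/
def shift : Hardy →L[ℂ] Hardy :=
  LinearMap.mkContinuous
    { toFun := fun f => ⟨fun z => (z : ℂ) * f z, ⟨_, memℓp_shiftSeq (coeff f)⟩,
        hasSum_shiftSeq_mul_pow f⟩
      map_add' := fun f g => Subtype.ext (funext fun z => mul_add (z : ℂ) (f z) (g z))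
      map_smul' := fun c f => Subtype.ext (funext fun z => mul_left_comm (z : ℂ) c (f z)) }
    1 fun f => by
      rw [one_mul]
      set g : Hardy := ⟨fun z => (z : ℂ) * f z, ⟨_, memℓp_shiftSeq (coeff f)⟩,
        hasSum_shiftSeq_mul_pow f⟩
      have hg : coeff g = ⟨_, memℓp_shiftSeq (coeff f)⟩ :=
        coeff_unique (hasSum_coeffFun g) (hasSum_shiftSeq_mul_pow f)
      have h1 : ‖coeff g‖ ^ (2 : ENNReal).toReal = ‖coeff f‖ ^ (2 : ENNReal).toReal := by
        rw [hg]
        exact (lp.hasSum_norm (p := 2) (by simp) _).unique (hasSum_shiftSeq (coeff f))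
      exact ((Real.rpow_left_inj (norm_nonneg _) (norm_nonneg _) (by simp)).1 h1).le

end Hardy

/-- The finite Blaschke product `c ∏ (z - a_j) / (1 - conj a_j z)`, with `|c| = 1` and zeros `a_j`
in the open unit disc, repeated according to multiplicity. -/
def blaschke {n : ℕ} (c : Circle) (a : Fin n → 𝔻) (z : 𝔻) : ℂ :=
  c * ∏ j, ((z : ℂ) - a j) / (1 - conj (a j : ℂ) * z)

/-- The subspace `Θ H²` of the functions in `H²` of the form `Θ h` with `h` in `H²`. -/
def mulRange (Θ : 𝔻 → ℂ) : Submodule ℂ Hardy where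
  carrier := {g | ∃ h : Hardy, ∀ z : 𝔻, g z = Θ z * h z}
  zero_mem' := ⟨0, fun z => (mul_zero (Θ z)).symm⟩
  add_mem' := by
    rintro f g ⟨h, hf⟩ ⟨k, hg⟩
    refine ⟨h + k, fun z => ?_⟩
    change f z + g z = Θ z * (h z + k z)
    rw [hf, hg, mul_add]
  smul_mem' := by
    rintro c f ⟨h, hf⟩
    refine ⟨c • h, fun z => ?_⟩
    change c * f z = Θ z * (c * h z)
    rw [hf, mul_left_comm]

/-- The model space `K_Θ = H² ⊖ Θ H²`. -/
abbrev modelSpace (Θ : 𝔻 → ℂ) : Submodule ℂ Hardy := (mulRange Θ)ᗮ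

/-- The compression of the shift `S_Θ = P_Θ S|_{K_Θ}`, where `P_Θ` is the orthogonal projection
of `H²` onto `K_Θ`. -/
def compressedShift (Θ : 𝔻 → ℂ) : modelSpace Θ →L[ℂ] modelSpace Θ :=
  (modelSpace Θ).orthogonalProjectionOnto ∘L Hardy.shift ∘L (modelSpace Θ).subtypeL

/-- The numerator `c ∏ (X - a_j)` of a finite Blaschke product. -/
def blaschkeNum {n : ℕ} (c : Circle) (a : Fin n → 𝔻) : ℂ[X] :=
  Polynomial.C (c : ℂ) * ∏ j, (Polynomial.X - Polynomial.C (a j : ℂ))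

/-- The denominator `∏ (1 - conj a_j X)` of a finite Blaschke product. -/
def blaschkeDen {n : ℕ} (a : Fin n → 𝔻) : ℂ[X] :=
  ∏ j, (1 - Polynomial.C (conj (a j : ℂ)) * Polynomial.X)

/-- The operator `B(T)`, for the finite Blaschke product `B = P / Q` with zeros `a_j`, given by the
rational functional calculus: `B(T) = P(T) Q(T)⁻¹`. For a contraction `T`, the operator `Q(T)` is
invertible; see `isUnit_aeval_blaschkeDen`. -/
def blaschkeOp {E : Type*} [NormedAddCommGroup E] [NormedSpace ℂ E] {n : ℕ} (c : Circle)
    (a : Fin n → 𝔻) (T : E →L[ℂ] E) : E →L[ℂ] E :=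
  Polynomial.aeval T (blaschkeNum c a) * Ring.inverse (Polynomial.aeval T (blaschkeDen a))

theorem isUnit_aeval_blaschkeDen {E : Type*} [NormedAddCommGroup E] [NormedSpace ℂ E]
    [CompleteSpace E] {n : ℕ} (a : Fin n → 𝔻) {T : E →L[ℂ] E} (hT : ‖T‖ ≤ 1) :
    IsUnit (Polynomial.aeval T (blaschkeDen a)) := by
  unfold blaschkeDen
  refine Finset.prod_induction _ (fun p : ℂ[X] => IsUnit (Polynomial.aeval T p))
    (fun p q hp hq => by rw [map_mul]; exact hp.mul hq) (by simp) fun j _ => ?_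
  have h : ‖conj (a j : ℂ) • T‖ < 1 := by
    rw [norm_smul, RCLike.norm_conj]
    exact (mul_le_of_le_one_right (norm_nonneg _) hT).trans_lt (a j).norm_lt_one
  have hu := isUnit_one_sub_of_norm_lt_one h
  simpa [Algebra.smul_def] using hu

theorem norm_compressedShift_le (Θ : 𝔻 → ℂ) : ‖compressedShift Θ‖ ≤ 1 := by
  refine ContinuousLinearMap.opNorm_le_bound _ zero_le_one fun x => ?_
  rw [one_mul]
  refine ((modelSpace Θ).norm_orthogonalProjectionOnto_apply_le (Hardy.shift x)).trans ?_
  have hS : ‖Hardy.shift‖ ≤ 1 := LinearMap.mkContinuous_norm_le _ zero_le_one _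
  simpa using Hardy.shift.le_of_opNorm_le hS (x : Hardy)

end ModelSpace

end

/-! Write `Θ = N/D` and `B = N₁/D₁` with polynomial numerators and denominators.

The closure of `ΘH²` is shift-invariant, so `P_Θ S = S_Θ P_Θ`, hence `P_Θ B(S) = B(S_Θ) P_Θ`. Since
`B(S)` is multiplication by `B` and is isometric, `‖B(S_Θ)x‖ = ‖P_Θ(Bx)‖ ≤ ‖Bx‖ = ‖x‖`, with
equality iff `Bx ∈ K_Θ` (`comp_blaschkeOp_eq`, `norm_blaschkeOp_apply`).

As `D(S)` is invertible, `ΘH²` is the range of `N(S)`, so `K_Θ` is the kernel of `N(S)*`. From `S*S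
= 1` this adjoint is a unimodular multiple of `S*ⁿ D(S)`, and `S*ⁿ` kills exactly the polynomials of
degree below `n`. So `f ∈ K_Θ` iff `Df` is such a polynomial (`mem_modelSpace_blaschke_iff`). With
`Dx = p`, the condition on `Bx` is that `N₁p/D₁` be a polynomial of degree below `n`; as `D₁` and
`N₁` are coprime, `p = D₁r` with `deg r < n - J`. -/

namespace ModelSpace

/-! ### The backward shift and polynomials in `H²` -/

namespace Hardy

theorem ext {f g : Hardy} (h : ∀ z : 𝔻, f z = g z) : f = g := Subtype.ext (funext h)

theorem shift_apply (f : Hardy) (z : 𝔻) : shift f z = z * f z := rfl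

theorem coeff_shift (f : Hardy) : coeff (shift f) = ⟨_, memℓp_shiftSeq (coeff f)⟩ :=
  coeff_unique (hasSum_coeffFun (shift f)) (hasSum_shiftSeq_mul_pow f)

theorem norm_shift (f : Hardy) : ‖shift f‖ = ‖f‖ := by
  have h1 : ‖coeff (shift f)‖ ^ (2 : ENNReal).toReal = ‖coeff f‖ ^ (2 : ENNReal).toReal := by
    rw [coeff_shift]
    exact (lp.hasSum_norm (p := 2) (by simp) _).unique (hasSum_shiftSeq (coeff f))
  exact (Real.rpow_left_inj (norm_nonneg _) (norm_nonneg _) (by simp)).1 h1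

theorem norm_shift_le : ‖shift‖ ≤ 1 := LinearMap.mkContinuous_norm_le _ zero_le_one _

theorem star_shift_mul_shift : star shift * shift = 1 :=
  (ContinuousLinearMap.norm_map_iff_adjoint_comp_self shift).1 norm_shift

/-- The monomial `z ↦ z ^ k`. -/
noncomputable def monomial (k : ℕ) : Hardy := coeff.symm (lp.single 2 k 1)

theorem coeff_monomial (k : ℕ) : coeff (monomial k) = lp.single 2 k 1 :=
  coeff.apply_symm_apply _

theorem inner_monomial_left (k : ℕ) (f : Hardy) : inner ℂ (monomial k) f = coeff f k := by
  change inner ℂ (coeff (monomial k)) (coeff f) = _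
  rw [coeff_monomial, lp.inner_single_left]
  simp

theorem shift_monomial (k : ℕ) : shift (monomial k) = monomial (k + 1) := by
  refine coeff.injective (lp.ext (funext fun m => ?_))
  rw [coeff_shift, coeff_monomial]
  cases m with
  | zero => simp [shiftSeq, coeff_monomial, lp.single_apply]
  | succ m => simp [shiftSeq, coeff_monomial, lp.single_apply, Pi.single_apply]

theorem coeff_star_shift (f : Hardy) (k : ℕ) : coeff (star shift f) k = coeff f (k + 1) := by
  rw [← inner_monomial_left, ContinuousLinearMap.star_eq_adjoint,
    ContinuousLinearMap.adjoint_inner_right, shift_monomial, inner_monomial_left]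

theorem coeff_star_shift_pow (n : ℕ) (f : Hardy) (k : ℕ) :
    coeff ((star shift ^ n) f) k = coeff f (k + n) := by
  induction n generalizing f with
  | zero => rfl
  | succ n ih =>
    rw [pow_succ, mul_apply_eq_comp, ih, coeff_star_shift]
    rfl

theorem star_shift_pow_eq_zero_iff (n : ℕ) (f : Hardy) :
    (star shift ^ n) f = 0 ↔ ∀ m, n ≤ m → coeff f m = 0 := by
  rw [← coeff.map_eq_zero_iff, lp.ext_iff, funext_iff]
  constructor
  · intro h m hm
    obtain ⟨k, rfl⟩ := Nat.exists_eq_add_of_le' hm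
    rw [← coeff_star_shift_pow, h]
    rfl
  · intro h k
    rw [coeff_star_shift_pow, h _ (Nat.le_add_left _ _)]
    rfl

/-- A function in the Hardy space that agrees with a polynomial on the disc has the coefficients
of the polynomial. -/
theorem coeff_eq_of_eval {f : Hardy} {p : ℂ[X]} (h : ∀ z : 𝔻, f z = p.eval (z : ℂ)) (m : ℕ) :
    coeff f m = p.coeff m := by
  have hp : Memℓp (fun k => p.coeff k) 2 := by
    -- Exponent `0` means finite support, which implies square-summability.
    refine (memℓp_zero ?_).of_exponent_ge zero_le
    exact p.support.finite_toSet.subset fun k hk => by simpa using hk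
  have hs : ∀ z : 𝔻, HasSum (fun k => (⟨_, hp⟩ : EllTwo) k * (z : ℂ) ^ k) (f z) := by
    intro z
    rw [h z, Polynomial.eval_eq_sum]
    exact hasSum_sum_of_ne_finset_zero fun k hk => by
      simp [Polynomial.notMem_support_iff.1 hk]
  rw [coeff_unique (f := fun z => f z) (a := coeff f) (hasSum_coeffFun f) hs]

/-- The coefficients of `f` vanish from `n` on iff `f` is a polynomial of degree less than `n`. -/
theorem star_shift_pow_eq_zero_iff_exists (n : ℕ) (f : Hardy) :
    (star shift ^ n) f = 0 ↔
      ∃ p : ℂ[X], p.degree < (n : WithBot ℕ) ∧ ∀ z : 𝔻, f z = p.eval (z : ℂ) := by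
  rw [star_shift_pow_eq_zero_iff]
  constructor
  · intro h
    refine ⟨∑ k ∈ Finset.range n, Polynomial.monomial k (coeff f k), ?_, fun z => ?_⟩
    · rw [Polynomial.degree_lt_iff_coeff_zero]
      intro m hm
      rw [Polynomial.finsetSum_coeff]
      refine Finset.sum_eq_zero fun k hk => ?_
      rw [Polynomial.coeff_monomial, if_neg]
      have := Finset.mem_range.1 hk
      omega
    · rw [Polynomial.eval_finsetSum]
      simp only [Polynomial.eval_monomial]
      refine (hasSum_coeffFun f z).unique (hasSum_sum_of_ne_finset_zero fun k hk => ?_)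
      have h0 : coeffFun f k = 0 := h k (by simpa using hk)
      rw [h0, zero_mul]
  · rintro ⟨p, hp, h⟩ m hm
    rw [coeff_eq_of_eval h]
    exact (Polynomial.degree_lt_iff_coeff_zero _ _).1 hp m hm

theorem aeval_shift_apply (p : ℂ[X]) (f : Hardy) (z : 𝔻) :
    Polynomial.aeval shift p f z = p.eval (z : ℂ) * f z := by
  induction p using Polynomial.induction_on' generalizing f with
  | add p q hp hq =>
    rw [map_add, Polynomial.eval_add, add_mul, ← hp, ← hq]
    rfl
  | monomial k c =>
    have hk : ∀ k : ℕ, (shift ^ k) f z = (z : ℂ) ^ k * f z := by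
      intro k
      induction k with
      | zero => exact (one_mul _).symm
      | succ k ih =>
        rw [pow_succ', mul_apply_eq_comp, shift_apply, ih, pow_succ', mul_assoc]
    rw [Polynomial.aeval_monomial, Polynomial.eval_monomial, mul_assoc, ← hk,
      ← Algebra.smul_def]
    rfl

end Hardy

/-! ### Blaschke products of an isometry -/

section Isometry

variable {A : Type*} [Ring A] [Algebra ℂ A]

/-- If `T S = 1`, then `T ^ n ∏ (1 - w_i S) = ∏ (T - w_i)`. -/
theorem pow_mul_aeval_prod {ι : Type*} {S T : A} (h : T * S = 1) (s : Finset ι) (w : ι → ℂ) :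
    T ^ s.card * Polynomial.aeval S (∏ i ∈ s, (1 - Polynomial.C (w i) * Polynomial.X)) =
      Polynomial.aeval T (∏ i ∈ s, (Polynomial.X - Polynomial.C (w i))) := by
  classical
  induction s using Finset.induction_on with
  | empty => simp
  | insert i s hi ih =>
    have h1 : T * Polynomial.aeval S (1 - Polynomial.C (w i) * Polynomial.X) =
        Polynomial.aeval T (Polynomial.X - Polynomial.C (w i)) := by
      simp [mul_sub, h, Algebra.algebraMap_eq_smul_one]
    have h2 : T ^ s.card * Polynomial.aeval T (Polynomial.X - Polynomial.C (w i)) =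
        Polynomial.aeval T (Polynomial.X - Polynomial.C (w i)) * T ^ s.card := by
      conv_lhs => rw [← Polynomial.aeval_X (R := ℂ) T, ← map_pow]
      conv_rhs => rw [← Polynomial.aeval_X (R := ℂ) T, ← map_pow]
      simp only [Polynomial.aeval_X]
      rw [← map_mul, ← map_mul, mul_comm]
    rw [Finset.prod_insert hi, Finset.prod_insert hi, Finset.card_insert_of_notMem hi, map_mul,
      map_mul, pow_succ, ← ih, mul_assoc, ← mul_assoc T, h1, ← mul_assoc, h2, mul_assoc]

theorem star_aeval [StarRing A] [StarModule ℂ A] (S : A) (p : ℂ[X]) :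
    star (Polynomial.aeval S p) = Polynomial.aeval (star S) (p.map (starRingEnd ℂ)) := by
  induction p using Polynomial.induction_on' with
  | add p q hp hq => simp [hp, hq]
  | monomial k c => simp [← Algebra.smul_def, Polynomial.aeval_monomial, star_smul]

variable {E : Type*} [NormedAddCommGroup E] [InnerProductSpace ℂ E]

/-- Both squares expand to `‖u‖² + |a|²‖u‖² - 2 Re(a⟨u, v⟩)`. With `u = Sy`, `v = y` this is the
isometry of a single Blaschke factor. -/
theorem norm_sub_smul_eq_of_norm_eq {u v : E} (h : ‖u‖ = ‖v‖) (a : ℂ) :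
    ‖u - a • v‖ = ‖v - conj a • u‖ := by
  rw [← sq_eq_sq₀ (norm_nonneg _) (norm_nonneg _), @norm_sub_sq ℂ, @norm_sub_sq ℂ,
    inner_smul_right, inner_smul_right, norm_smul, norm_smul, RCLike.norm_conj, h,
    ← inner_conj_symm u v, ← RCLike.conj_re, map_mul, RCLike.conj_conj]

theorem norm_aeval_prod_eq {ι : Type*} {S : E →L[ℂ] E} (h : ∀ x, ‖S x‖ = ‖x‖) (s : Finset ι)
    (a : ι → ℂ) (x : E) :
    ‖Polynomial.aeval S (∏ i ∈ s, (Polynomial.X - Polynomial.C (a i))) x‖ =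
      ‖Polynomial.aeval S (∏ i ∈ s, (1 - Polynomial.C (conj (a i)) * Polynomial.X)) x‖ := by
  classical
  induction s using Finset.induction_on generalizing x with
  | empty => simp
  | insert i s hi ih =>
    have key : ∀ y, ‖Polynomial.aeval S (Polynomial.X - Polynomial.C (a i)) y‖ =
        ‖Polynomial.aeval S (1 - Polynomial.C (conj (a i)) * Polynomial.X) y‖ := by
      intro y
      simpa [← Algebra.smul_def, Algebra.algebraMap_eq_smul_one] using
        norm_sub_smul_eq_of_norm_eq (h y) (a i)
    -- The factors commute: the `i`-th is exchanged first, then moved inside so that `ih` applies at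
    -- its image of `x`.
    rw [Finset.prod_insert hi, Finset.prod_insert hi, map_mul, mul_apply_eq_comp, key,
      ← mul_apply_eq_comp, ← map_mul, mul_comm, map_mul,
      mul_apply_eq_comp, ih, ← mul_apply_eq_comp, ← map_mul, mul_comm]

theorem norm_blaschkeOp_apply [CompleteSpace E] {J : ℕ} (c : Circle) (a : Fin J → 𝔻)
    {S : E →L[ℂ] E} (h : ∀ x, ‖S x‖ = ‖x‖) (x : E) : ‖blaschkeOp c a S x‖ = ‖x‖ := by
  have hS : ‖S‖ ≤ 1 := S.opNorm_le_bound zero_le_one fun y => by rw [h, one_mul]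
  have hu := isUnit_aeval_blaschkeDen a hS
  rw [blaschkeOp, mul_apply_eq_comp, blaschkeNum, map_mul,
    mul_apply_eq_comp, Polynomial.aeval_C, Algebra.algebraMap_eq_smul_one,
    smul_apply, norm_smul, Circle.norm_coe, one_mul,
    one_apply_eq_self, norm_aeval_prod_eq h]
  change ‖(Polynomial.aeval S (blaschkeDen a) * Ring.inverse _) x‖ = _
  rw [Ring.mul_inverse_cancel _ hu, one_apply_eq_self]

end Isometry

/-! ### Intertwining the shift with its compression -/

section Compression

variable {E F : Type*} [NormedAddCommGroup E] [NormedSpace ℂ E] [NormedAddCommGroup F]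
  [NormedSpace ℂ F]

theorem comp_aeval_eq {P : E →L[ℂ] F} {S : E →L[ℂ] E} {T : F →L[ℂ] F}
    (h : ∀ x, P (S x) = T (P x)) (p : ℂ[X]) (x : E) :
    P (Polynomial.aeval S p x) = Polynomial.aeval T p (P x) := by
  induction p using Polynomial.induction_on' with
  | add p q hp hq => simp [hp, hq]
  | monomial k c =>
    have hk : P ((S ^ k) x) = (T ^ k) (P x) := by
      induction k with
      | zero => rfl
      | succ k ih => simp only [pow_succ', mul_apply_eq_comp, h, ih]
    rw [Polynomial.aeval_monomial, Polynomial.aeval_monomial, ← Algebra.smul_def,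
      ← Algebra.smul_def, smul_apply, smul_apply, map_smul, hk]

theorem comp_blaschkeOp_eq [CompleteSpace E] [CompleteSpace F] {J : ℕ} (c : Circle)
    (a : Fin J → 𝔻) {P : E →L[ℂ] F} {S : E →L[ℂ] E} {T : F →L[ℂ] F} (hS : ‖S‖ ≤ 1)
    (hT : ‖T‖ ≤ 1) (h : ∀ x, P (S x) = T (P x)) (x : E) :
    P (blaschkeOp c a S x) = blaschkeOp c a T (P x) := by
  have hSu := Ring.mul_inverse_cancel _ (isUnit_aeval_blaschkeDen a hS)
  have hTu := Ring.inverse_mul_cancel _ (isUnit_aeval_blaschkeDen a hT)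
  rw [blaschkeOp, blaschkeOp, mul_apply_eq_comp, mul_apply_eq_comp,
    comp_aeval_eq h]
  congr 1
  -- Writing `x = Q(S)y`, with `Q` the denominator, reduces the inverses to the polynomial case.
  set y := Ring.inverse (Polynomial.aeval S (blaschkeDen a)) x with hy
  have hx : x = Polynomial.aeval S (blaschkeDen a) y := by
    rw [hy, ← mul_apply_eq_comp, hSu, one_apply_eq_self]
  rw [hx, comp_aeval_eq h, ← mul_apply_eq_comp, hTu, one_apply_eq_self]

theorem orthogonalProjectionOnto_shift (Θ : 𝔻 → ℂ) (f : Hardy) :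
    (modelSpace Θ).orthogonalProjectionOnto (Hardy.shift f) =
      compressedShift Θ ((modelSpace Θ).orthogonalProjectionOnto f) := by
  have hinv : ∀ g ∈ (modelSpace Θ)ᗮ, Hardy.shift g ∈ (modelSpace Θ)ᗮ := by
    intro g hg
    rw [Submodule.orthogonal_orthogonal_eq_closure] at hg ⊢
    refine map_mem_closure Hardy.shift.continuous hg ?_
    rintro g ⟨h, hg⟩
    refine ⟨Hardy.shift h, fun z => ?_⟩
    change (z : ℂ) * g z = _ * ((z : ℂ) * h z)
    rw [hg]
    ring
  change _ = (modelSpace Θ).orthogonalProjectionOnto (Hardy.shift _)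
  -- It remains that `S(f - P_Θ f)` is orthogonal to `K_Θ`.
  rw [← sub_eq_zero, ← map_sub, ← map_sub, Submodule.orthogonalProjectionOnto_eq_zero_iff]
  exact hinv _ ((modelSpace Θ).sub_starProjection_mem_orthogonal f)

end Compression

/-! ### Finite Blaschke products and their model spaces -/

theorem one_sub_conj_mul_ne_zero (a z : 𝔻) : 1 - conj (a : ℂ) * z ≠ 0 := by
  intro h
  have h1 : ‖conj (a : ℂ) * z‖ = 1 := by rw [← sub_eq_zero.1 h, norm_one]
  rw [norm_mul, RCLike.norm_conj] at h1
  exact (mul_lt_one_of_nonneg_of_lt_one_left (norm_nonneg _) a.norm_lt_one z.norm_lt_one.le).ne h1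

theorem eval_blaschkeDen {n : ℕ} (a : Fin n → 𝔻) (z : ℂ) :
    (blaschkeDen a).eval z = ∏ j, (1 - conj (a j : ℂ) * z) := by
  simp [blaschkeDen, Polynomial.eval_prod]

theorem eval_blaschkeDen_ne_zero {n : ℕ} (a : Fin n → 𝔻) (z : 𝔻) :
    (blaschkeDen a).eval (z : ℂ) ≠ 0 := by
  rw [eval_blaschkeDen]
  exact Finset.prod_ne_zero_iff.2 fun j _ => one_sub_conj_mul_ne_zero _ _

theorem blaschke_eq_div {n : ℕ} (c : Circle) (a : Fin n → 𝔻) (z : 𝔻) :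
    blaschke c a z = (blaschkeNum c a).eval (z : ℂ) / (blaschkeDen a).eval (z : ℂ) := by
  simp [blaschke, blaschkeNum, eval_blaschkeDen, Polynomial.eval_prod, Finset.prod_div_distrib,
    mul_div_assoc]

theorem blaschkeOp_shift_apply {n : ℕ} (c : Circle) (a : Fin n → 𝔻) (f : Hardy) (z : 𝔻) :
    blaschkeOp c a Hardy.shift f z = blaschke c a z * f z := by
  have hu := Ring.mul_inverse_cancel _ (isUnit_aeval_blaschkeDen a Hardy.norm_shift_le)
  have hf : Polynomial.aeval Hardy.shift (blaschkeDen a)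
      (Ring.inverse (Polynomial.aeval Hardy.shift (blaschkeDen a)) f) = f := by
    rw [← mul_apply_eq_comp, hu, one_apply_eq_self]
  rw [blaschkeOp, mul_apply_eq_comp, Hardy.aeval_shift_apply, blaschke_eq_div]
  conv_rhs => rw [← hf, Hardy.aeval_shift_apply]
  rw [← mul_assoc, div_mul_cancel₀ _ (eval_blaschkeDen_ne_zero a z)]

theorem mulRange_blaschke {n : ℕ} (γ : Circle) (ζ : Fin n → 𝔻) :
    mulRange (blaschke γ ζ) =
      (Polynomial.aeval Hardy.shift (blaschkeNum γ ζ) : Hardy →ₗ[ℂ] Hardy).range := by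
  ext g
  constructor
  · rintro ⟨h, hg⟩
    exact ⟨Ring.inverse (Polynomial.aeval Hardy.shift (blaschkeDen ζ)) h,
      Hardy.ext fun z => ((hg z).trans (blaschkeOp_shift_apply γ ζ h z).symm).symm⟩
  · rintro ⟨k, rfl⟩
    refine ⟨Polynomial.aeval Hardy.shift (blaschkeDen ζ) k, fun z => ?_⟩
    rw [Hardy.aeval_shift_apply, blaschke_eq_div, ← mul_assoc,
      div_mul_cancel₀ _ (eval_blaschkeDen_ne_zero ζ z)]
    exact Hardy.aeval_shift_apply _ _ _

theorem star_aeval_shift_blaschkeNum {n : ℕ} (γ : Circle) (ζ : Fin n → 𝔻) :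
    star (Polynomial.aeval Hardy.shift (blaschkeNum γ ζ)) =
      conj (γ : ℂ) • (star Hardy.shift ^ n * Polynomial.aeval Hardy.shift (blaschkeDen ζ)) := by
  have h := pow_mul_aeval_prod Hardy.star_shift_mul_shift Finset.univ fun i => conj (ζ i : ℂ)
  rw [Finset.card_univ, Fintype.card_fin] at h
  rw [star_aeval, blaschkeDen, h, blaschkeNum, Polynomial.map_mul, Polynomial.map_prod, map_mul,
    Polynomial.map_C, Polynomial.aeval_C, ← Algebra.smul_def]
  simp only [Polynomial.map_sub, Polynomial.map_X, Polynomial.map_C]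

/-- The model space of a finite Blaschke product with `n` zeros consists of the functions
`p / ∏ (1 - conj ζ_i z)` with `p` a polynomial of degree less than `n`. -/
theorem mem_modelSpace_blaschke_iff {n : ℕ} (γ : Circle) (ζ : Fin n → 𝔻) (f : Hardy) :
    f ∈ modelSpace (blaschke γ ζ) ↔ ∃ p : ℂ[X], p.degree < (n : WithBot ℕ) ∧
      ∀ z : 𝔻, (blaschkeDen ζ).eval (z : ℂ) * f z = p.eval (z : ℂ) := by
  rw [modelSpace, mulRange_blaschke, ContinuousLinearMap.orthogonal_range, LinearMap.mem_ker,
    ← ContinuousLinearMap.star_eq_adjoint, star_aeval_shift_blaschkeNum]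
  simp only [← Hardy.aeval_shift_apply]
  rw [← Hardy.star_shift_pow_eq_zero_iff_exists]
  change conj (γ : ℂ) • (star Hardy.shift ^ n) (Polynomial.aeval Hardy.shift (blaschkeDen ζ) f) = 0
    ↔ _
  rw [smul_eq_zero_iff_right]
  simp

/-- Factorwise, `(1 - āᵢX) + āᵢ(X - aⱼ)` is the nonzero constant `1 - āᵢaⱼ`. -/
theorem isCoprime_blaschkeDen_blaschkeNum {n : ℕ} (c : Circle) (a : Fin n → 𝔻) :
    IsCoprime (blaschkeDen a) (blaschkeNum c a) := by
  refine IsCoprime.prod_left fun i _ => IsCoprime.mul_right ?_ (IsCoprime.prod_right fun j _ => ?_)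
  · exact isCoprime_one_right.of_isCoprime_of_dvd_right (Polynomial.isUnit_C.2 (by simp)).dvd
  · refine ⟨Polynomial.C (1 - conj (a i : ℂ) * a j)⁻¹,
      Polynomial.C (1 - conj (a i : ℂ) * a j)⁻¹ * Polynomial.C (conj (a i : ℂ)), ?_⟩
    have h : Polynomial.C (1 - conj (a i : ℂ) * a j)⁻¹ *
        (1 - Polynomial.C (conj (a i : ℂ)) * Polynomial.C (a j : ℂ)) = 1 := by
      rw [← Polynomial.C_mul, ← Polynomial.C_1, ← Polynomial.C_sub, ← Polynomial.C_mul, inv_mul_cancel₀ (one_sub_conj_mul_ne_zero _ _)]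
    linear_combination h

theorem degree_blaschkeNum {n : ℕ} (c : Circle) (a : Fin n → 𝔻) :
    (blaschkeNum c a).degree = n := by
  rw [blaschkeNum, Polynomial.degree_C_mul (by simp), Polynomial.degree_prod]
  simp

theorem eq_of_eval_unitDisc_eq {p q : ℂ[X]} (h : ∀ z : 𝔻, p.eval (z : ℂ) = q.eval (z : ℂ)) :
    p = q := by
  refine Polynomial.eq_of_infinite_eval_eq p q
    ((infinite_of_mem_nhds (0 : ℂ) (Metric.ball_mem_nhds 0 one_pos)).mono fun z hz => ?_)
  exact h (Complex.UnitDisc.mk z (by simpa using hz))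

theorem degree_mul_lt_iff {p q : ℂ[X]} {J n : ℕ} (hJ : J < n) (hq : q.degree = J) :
    (q * p).degree < (n : WithBot ℕ) ↔ p.degree < ((n - J : ℕ) : WithBot ℕ) := by
  rcases eq_or_ne p 0 with rfl | hp
  · simp
  · rw [Polynomial.degree_mul, hq, Polynomial.degree_eq_natDegree hp]
    norm_cast
    omega

end ModelSpace

open ModelSpace in
theorem mainTheorem12 {n J : ℕ} (hJ : J < n)
    (γ : Circle) (ζ : Fin n → Complex.UnitDisc)
    (c : Circle) (a : Fin J → Complex.UnitDisc)
    (x : ModelSpace.modelSpace (ModelSpace.blaschke γ ζ)) :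
    List.TFAE
      [‖ModelSpace.blaschkeOp c a
          (ModelSpace.compressedShift (ModelSpace.blaschke γ ζ)) x‖ = ‖x‖,
        ∃ y ∈ ModelSpace.modelSpace (ModelSpace.blaschke γ ζ),
          ∀ z : Complex.UnitDisc, y z = ModelSpace.blaschke c a z * (x : ModelSpace.Hardy) z,
        ∃ p : Polynomial ℂ, p.degree < ((n - J : ℕ) : WithBot ℕ) ∧
          ∀ z : Complex.UnitDisc, (x : ModelSpace.Hardy) z =
            p.eval (z : ℂ) * (∏ j, (1 - (starRingEnd ℂ) (a j : ℂ) * (z : ℂ))) /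
              ∏ i, (1 - (starRingEnd ℂ) (ζ i : ℂ) * (z : ℂ))] := by
  have hB : (∃ y ∈ modelSpace (blaschke γ ζ), ∀ z : 𝔻, y z = blaschke c a z * (x : Hardy) z) ↔
      blaschkeOp c a Hardy.shift x ∈ modelSpace (blaschke γ ζ) := by
    constructor
    · rintro ⟨y, hy, h⟩
      rwa [show blaschkeOp c a Hardy.shift x = y from
        Hardy.ext fun z => (blaschkeOp_shift_apply c a x z).trans (h z).symm]
    · exact fun h => ⟨_, h, blaschkeOp_shift_apply c a x⟩
  tfae_have 1 ↔ 2 := by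
    have h := comp_blaschkeOp_eq c a Hardy.norm_shift_le (norm_compressedShift_le (blaschke γ ζ))
      (orthogonalProjectionOnto_shift (blaschke γ ζ)) (x : Hardy)
    rw [Submodule.orthogonalProjectionOnto_mem_subspace_eq_self] at h
    refine Iff.trans ?_ hB.symm
    -- A vector lies in `K_Θ` iff projecting preserves its norm; here that norm is `‖Bx‖ = ‖x‖`.
    rw [← h, Submodule.mem_iff_norm_starProjection, norm_blaschkeOp_apply c a Hardy.norm_shift]
    rfl
  tfae_have 2 ↔ 3 := by
    refine hB.trans ?_
    rw [mem_modelSpace_blaschke_iff]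
    simp only [blaschkeOp_shift_apply, ← eval_blaschkeDen, blaschke_eq_div]
    have ha := eval_blaschkeDen_ne_zero a
    have hζ := eval_blaschkeDen_ne_zero ζ
    constructor
    · rintro ⟨q, hq, hqx⟩
      obtain ⟨p, -, hpx⟩ := (mem_modelSpace_blaschke_iff γ ζ _).1 x.2
      have hpq : blaschkeNum c a * p = blaschkeDen a * q := by
        refine eq_of_eval_unitDisc_eq fun z => ?_
        rw [Polynomial.eval_mul, Polynomial.eval_mul, ← hqx, ← hpx]
        field_simp [ha z]
      obtain ⟨r, rfl⟩ := (isCoprime_blaschkeDen_blaschkeNum c a).dvd_of_dvd_mul_left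
        (Dvd.intro _ hpq.symm)
      have hD : blaschkeDen a ≠ 0 := fun h => ha 0 (by rw [h, Polynomial.eval_zero])
      rw [mul_left_comm] at hpq
      -- Cancelling the denominator of `B` gives `q` as its numerator times `r`, so the bound on `q`
      -- becomes one on `r`.
      rw [← mul_left_cancel₀ hD hpq, degree_mul_lt_iff hJ (degree_blaschkeNum c a)] at hq
      refine ⟨r, hq, fun z => ?_⟩
      rw [eq_div_iff (hζ z), mul_comm, hpx, Polynomial.eval_mul, mul_comm]
    · rintro ⟨p, hp, hpx⟩
      refine ⟨blaschkeNum c a * p, (degree_mul_lt_iff hJ (degree_blaschkeNum c a)).2 hp,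
        fun z => ?_⟩
      rw [hpx, Polynomial.eval_mul]
      field_simp [ha z, hζ z]
  tfae_finish
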